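/- Let $p>2$ be a prime, $\zeta_p$ a primitive $p$-th root of unity, $K=\mathbb{Q}(\zeta_p)$, and $\mathfrak{p}$ the unique prime ideal of $K$ above $p$. For a prime $\ell\equiv 1 \pmod p$, let $\xi_\ell$ be a primitive $\ell$-th root of unity, let $F_\ell$ be the subfield of $\mathbb{Q}(\xi_\ell)$ of degree $p$ over $\mathbb{Q}$, and let $R_\ell\in\mathbb{F}_p[x]$ be the reduction modulo $p$ of the polynomial $$Q_\ell=\prod_{\sigma\in\mathrm{Gal}(F_\ell/\mathbb{Q})}\bigl(x-\sigma(\mathrm{Tr}_{\mathbb{Q}(\xi_\ell)/F_\ell}(\xi_\ell))\bigr)\in\mathbb{Z}[x].$$ For a character $\psi$ of $\mathbb{F}_\ell^\times$ of order $p$, put $\tau(\psi)=-\sum_{x\in\mathbb{F}_\ell^\times}\psi(x)\,\xi_\ell^x$. Let $\ell_1,\ell_2\equiv 1\pmod p$ be primes, let $g_i$ be a primitive root modulo $\ell_i$, and let $\psi_i$ be the character of $\mathbb{F}_{\ell_i}^\times$ of order $p$ with $\psi_i(g_i)=\zeta_p$ ($i=1,2$). Let $F=F_{\ell_1}F_{\ell_2}$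 and let $Z_{FK}$ be the ring of integers of $FK$. Then $\tau(\psi_1),\tau(\psi_2)\in Z_{FK}$ and, if $R_{\ell_1}\neq R_{\ell_2}$, then for every $\sigma\in\mathrm{Gal}(FK/\mathbb{Q})$, $$\tau(\psi_2)\not\equiv\tau(\psi_1)^{\sigma}\pmod{\mathfrak{p}^p Z_{FK}}.$$ -/

import Mathlib

open Polynomial IntermediateField NumberField

noncomputable section

/-- The relative trace `Tr_{ℚ(ξ)/F}(ξ)`, as an element of the subextension `F` of `ℚ(ξ)/ℚ`. -/
def relTrace {Ω : Type*} [Field Ω] [CharZero Ω] (ξ : Ω) (F : IntermediateField ℚ ℚ⟮ξ⟯) : F :=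
  Algebra.trace F ℚ⟮ξ⟯ (AdjoinSimple.gen ℚ ξ)

/-- The polynomial `∏_{σ ∈ Gal(F/ℚ)} (X - σ(Tr_{ℚ(ξ)/F}(ξ)))`, with coefficients in `F`. -/
def conjPoly {Ω : Type*} [Field Ω] [CharZero Ω] (ξ : Ω) (F : IntermediateField ℚ ℚ⟮ξ⟯) : F[X] :=
  ∏ᶠ σ : Gal(F/ℚ), (X - C (σ (relTrace ξ F)))

/-- When `ξ` is a root of unity, `conjPoly ξ F` has integer coefficients. -/
theorem exists_int_conjPoly {Ω : Type*} [Field Ω] [CharZero Ω] {n : ℕ} (hn : n ≠ 0) {ξ : Ω}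
    (hξ : IsPrimitiveRoot ξ n) (F : IntermediateField ℚ ℚ⟮ξ⟯) :
    ∃ Q : ℤ[X], Q.map (Int.castRingHom F) = conjPoly ξ F := by
  have : NeZero n := ⟨hn⟩
  have : IsCyclotomicExtension {n} ℚ ℚ⟮ξ⟯ := by
    change IsCyclotomicExtension {n} ℚ ℚ⟮ξ⟯.toSubalgebra
    rw [adjoin_simple_toSubalgebra_of_isAlgebraic
      ((hξ.isIntegral (Nat.pos_of_ne_zero hn)).tower_top (A := ℚ)).isAlgebraic]
    exact hξ.adjoin_isCyclotomicExtension ℚ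
  have : NumberField ℚ⟮ξ⟯ := IsCyclotomicExtension.numberField {n} ℚ _
  have : IsAbelianGalois ℚ ℚ⟮ξ⟯ := IsCyclotomicExtension.isAbelianGalois {n} ℚ _
  have : FiniteDimensional ℚ F := inferInstance
  have : NumberField F := {}
  have hint : IsIntegral ℤ (AdjoinSimple.gen ℚ ξ) := by
    refine IsIntegral.of_pow (Nat.pos_of_ne_zero hn) ?_
    have : (AdjoinSimple.gen ℚ ξ) ^ n = 1 := by
      apply Subtype.ext
      simpa using hξ.pow_eq_one
    rw [this]
    exact isIntegral_one
  have ht : IsIntegral ℤ (relTrace ξ F) := Algebra.isIntegral_trace hint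
  have : IsAbelianGalois ℚ F := IsAbelianGalois.tower_bot ℚ F ℚ⟮ξ⟯
  have : IsGaloisGroup Gal(F/ℚ) ℚ F := inferInstance
  have : IsGaloisGroup Gal(F/ℚ) ℤ (𝓞 F) := inferInstance
  obtain ⟨t, ht⟩ : ∃ t : 𝓞 F, (t : F) = relTrace ξ F :=
    ⟨⟨relTrace ξ F, ht⟩, rfl⟩
  obtain ⟨Q, hQ⟩ := (mem_lifts _).mp
    (Algebra.IsInvariant.charpoly_mem_lifts ℤ (𝓞 F) Gal(F/ℚ) t)
  refine ⟨Q, ?_⟩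
  have h2 := congrArg (Polynomial.map (algebraMap (𝓞 F) F)) hQ
  rw [Polynomial.map_map, MulSemiringAction.charpoly_eq, Polynomial.map_prod,
    RingHom.ext_int ((algebraMap (𝓞 F) F).comp _) (Int.castRingHom F)] at h2
  rw [conjPoly, finprod_eq_prod_of_fintype, h2, ← ht]
  refine Finset.prod_congr rfl fun σ _ => ?_
  simp only [Polynomial.map_sub, map_X, map_C]
  rfl

open Classical in
/-- `conjPoly ξ F` as a polynomial in `ℤ[X]` (the lift is unique, because `ℤ → F` is injective, and
exists by `exists_int_conjPoly`). -/
def intPoly {Ω : Type*} [Field Ω] [CharZero Ω] (ξ : Ω) (F : IntermediateField ℚ ℚ⟮ξ⟯) : ℤ[X] :=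
  if h : ∃ Q : ℤ[X], Q.map (Int.castRingHom F) = conjPoly ξ F then h.choose else 0

theorem map_intPoly {Ω : Type*} [Field Ω] [CharZero Ω] {n : ℕ} (hn : n ≠ 0) {ξ : Ω}
    (hξ : IsPrimitiveRoot ξ n) (F : IntermediateField ℚ ℚ⟮ξ⟯) :
    (intPoly ξ F).map (Int.castRingHom F) = conjPoly ξ F := by
  have h := exists_int_conjPoly hn hξ F
  rw [intPoly, dif_pos h]
  exact h.choose_spec

/-- The reduction modulo `p` of the integer polynomial whose roots are the conjugates of
`Tr_{ℚ(ξ)/F}(ξ)`. -/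
def redPoly (p : ℕ) {Ω : Type*} [Field Ω] [CharZero Ω] (ξ : Ω) (F : IntermediateField ℚ ℚ⟮ξ⟯) :
    (ZMod p)[X] :=
  (intPoly ξ F).map (Int.castRingHom (ZMod p))

/-- The Gauss sum `τ(ψ) = - ∑_{x ∈ 𝔽_ℓˣ} ψ(x) ξ^x`. -/
def tau {ℓ : ℕ} [Fact ℓ.Prime] {Ω : Type*} [Field Ω] (ψ : (ZMod ℓ)ˣ →* Ω) (ξ : Ω) : Ω :=
  -∑ x : (ZMod ℓ)ˣ, ψ x * ξ ^ (x : ZMod ℓ).val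

/-- The compositum `F₁F₂K` inside `Ω`, where `K = ℚ(ζ)`. -/
abbrev compositumFK {Ω : Type*} [Field Ω] [CharZero Ω] (ζ : Ω) {ξ₁ ξ₂ : Ω}
    (F₁ : IntermediateField ℚ ℚ⟮ξ₁⟯) (F₂ : IntermediateField ℚ ℚ⟮ξ₂⟯) : IntermediateField ℚ Ω :=
  IntermediateField.lift F₁ ⊔ IntermediateField.lift F₂ ⊔ ℚ⟮ζ⟯

/-- The ring homomorphism `Z_K → Z_{F₁F₂K}` given by the inclusion of `K = ℚ(ζ)`. -/
def inclFK {Ω : Type*} [Field Ω] [CharZero Ω] (ζ : Ω) {ξ₁ ξ₂ : Ω}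
    (F₁ : IntermediateField ℚ ℚ⟮ξ₁⟯) (F₂ : IntermediateField ℚ ℚ⟮ξ₂⟯) :
    𝓞 ℚ⟮ζ⟯ →+* 𝓞 (compositumFK ζ F₁ F₂) :=
  RingOfIntegers.mapRingHom
    (IntermediateField.inclusion (le_sup_right : ℚ⟮ζ⟯ ≤ compositumFK ζ F₁ F₂))

end

/-! Sorting the Gauss sum by character values gives `τ(ψ) = -∑ ζ^i η_i`, where the Gaussian periods
`η_i` are the conjugates of the trace of `ξ`, hence the roots of `Q_ℓ`. An automorphism only
permutes the periods against the powers of `ζ` (`exists_perm_apply_tau`), so a congruence modulo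
`𝔭^p` says that `π^p`, with `π = ζ - 1`, divides `∑ ζ^i c_i`, where each `c_i` is a difference of a
period for `ℓ₁` and one for `ℓ₂`.

Both families of periods have sum `-1`, so `∑ c_i = 0`, and the `c_i` lie in `ℤ[ξ₁, ξ₂]`, where `π ∣
a` forces `p ∣ a` (`natCast_dvd_of_sub_one_dvd`). Expanding in powers of `π` then shows that `p`
divides every `c_i` (`dvd_of_sub_one_pow_dvd_sum`). The two sets of roots thus agree modulo `p` up
to a permutation, so `R_{ℓ₁} = R_{ℓ₂}`. -/

noncomputable section

/-! ### Divisibility by `p` and expansions in powers of `ζ - 1`. -/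

/-- Modulo a prime `p`, a ring generated by elements satisfying `s ^ (p ^ m) = s` consists of
elements satisfying `a ^ (p ^ m) ≡ a`. -/
theorem dvd_pow_prime_pow_sub_self_of_mem_adjoin {B : Type*} [CommRing B] {p : ℕ} [Fact p.Prime]
    (m : ℕ) (S : Set B) (hS : ∀ s ∈ S, s ^ p ^ m = s) {a : B} (ha : a ∈ Algebra.adjoin ℤ S) :
    (p : B) ∣ a ^ p ^ m - a := by
  by_cases hu : IsUnit (p : B)
  · exact hu.dvd
  have : CharP (B ⧸ Ideal.span {(p : B)}) p := CharP.quotient B p hu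
  have : ExpChar (B ⧸ Ideal.span {(p : B)}) p := .prime Fact.out
  suffices h : iterateFrobenius (B ⧸ Ideal.span {(p : B)}) p m (Ideal.Quotient.mk _ a) =
      Ideal.Quotient.mk _ a by
    rw [iterateFrobenius_def, ← map_pow, Ideal.Quotient.eq, Ideal.mem_span_singleton] at h
    exact h
  induction ha using Algebra.adjoin_induction with
  | mem s hs => rw [iterateFrobenius_def, ← map_pow, hS s hs]
  | algebraMap n => simp
  | add x y _ _ hx hy => rw [map_add, map_add, hx, hy]
  | mul x y _ _ hx hy => rw [map_mul, map_mul, hx, hy]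

/-- Evaluating the cyclotomic polynomial at `1` gives `p = ∏ (1 - ζ^i)` over `i` prime to `p`, and
each factor is associated to `ζ - 1`. -/
theorem IsPrimitiveRoot.associated_sub_one_pow_prime {B : Type*} [CommRing B] [IsDomain B] {p : ℕ}
    [hp : Fact p.Prime] {ζ : B} (hζ : IsPrimitiveRoot ζ p) :
    Associated ((ζ - 1) ^ (p - 1)) (p : B) := by
  rw [← eval_one_cyclotomic_prime (R := B) (p := p),
    cyclotomic_eq_prod_X_sub_primitiveRoots hζ, eval_prod]
  simp only [eval_sub, eval_X, eval_C]
  rw [← Nat.totient_prime hp.out, ← hζ.card_primitiveRoots, ← Finset.prod_const]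
  refine Associated.prod _ _ _ fun η hη ↦ ?_
  obtain ⟨i, -, hi, rfl⟩ := hζ.isPrimitiveRoot_iff.mp (isPrimitiveRoot_of_mem_primitiveRoots hη)
  rw [← neg_sub (ζ ^ i) 1]
  exact (hζ.associated_sub_one_pow_sub_one_of_coprime hi).neg_right

/-- A `π`-adic expansion with coefficients in a ring where `π ∣ a` forces `p ∣ a`, of degree less
than `p` and without constant term, vanishes modulo `π ^ p` only if it vanishes modulo `p`. -/
theorem dvd_coeff_of_pow_dvd_aeval {B : Type*} [CommRing B] [IsDomain B] {p : ℕ} {π : B}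
    (hπ0 : π ≠ 0) (hπ : π ^ (p - 1) ∣ (p : B)) (A : Subalgebra ℤ B)
    (hA : ∀ a ∈ A, π ∣ a → (p : B) ∣ a) (g : A[X]) (hg : g.natDegree < p) (h0 : g.coeff 0 = 0)
    (hdvd : π ^ p ∣ aeval π g) (j : ℕ) : (p : B) ∣ (g.coeff j : B) := by
  induction j using Nat.strong_induction_on with
  | _ j ih =>
    rcases Nat.eq_zero_or_pos j with rfl | hj
    · simp [h0]
    rcases le_or_gt p j with hpj | hpj
    · simp [coeff_eq_zero_of_natDegree_lt (hg.trans_le hpj)]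
    apply hA _ (g.coeff j).2
    -- For `0 < k < j`, induction gives divisibility by `π^(p-1+k)`, and `p - 1 + k ≥ p ≥ j + 1`. A
    -- constant term would supply only `π^(p-1)`, which is not enough at `j = p - 1`; hence `h0`.
    have hother : ∀ k ∈ (Finset.range p).erase j, π ^ (j + 1) ∣ g.coeff k • π ^ k := by
      intro k hk
      rw [Finset.mem_erase, Finset.mem_range] at hk
      rw [Subalgebra.smul_def, smul_eq_mul]
      rcases lt_or_gt_of_ne hk.1 with hkj | hkj
      · rcases Nat.eq_zero_or_pos k with rfl | hk0
        · simp [h0]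
        · refine (pow_dvd_pow π (show j + 1 ≤ (p - 1) + k by omega)).trans ?_
          rw [pow_add]
          exact mul_dvd_mul_right (hπ.trans (ih k hkj)) _
      · exact (pow_dvd_pow π hkj).trans (dvd_mul_left _ _)
    have hsum := (pow_dvd_pow π (Nat.succ_le_of_lt hpj)).trans hdvd
    rw [aeval_eq_sum_range' hg, ← Finset.add_sum_erase _ _ (Finset.mem_range.mpr hpj),
      dvd_add_left (Finset.dvd_sum hother), Subalgebra.smul_def, smul_eq_mul, pow_succ,
      mul_comm] at hsum
    exact (mul_dvd_mul_iff_right (pow_ne_zero j hπ0)).mp (by rwa [mul_comm] at hsum ⊢)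

/-- If the sum `∑ ζ ^ i c_i` vanishes modulo `(ζ - 1) ^ p`, where the `c_i` have sum zero and lie
in a ring which is unramified at `p`, then `p` divides all the `c_i`. -/
theorem dvd_of_sub_one_pow_dvd_sum {B : Type*} [CommRing B] [IsDomain B] {p : ℕ}
    [hp : Fact p.Prime] {ζ : B} (hζ : IsPrimitiveRoot ζ p) (A : Subalgebra ℤ B)
    (hA : ∀ a ∈ A, ζ - 1 ∣ a → (p : B) ∣ a) (c : ZMod p → B) (hc : ∀ i, c i ∈ A)
    (hsum : ∑ i, c i = 0) (hdvd : (ζ - 1) ^ p ∣ ∑ i, ζ ^ i.val * c i) (i : ZMod p) :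
    (p : B) ∣ c i := by
  set f : A[X] := ∑ i : ZMod p, monomial i.val (⟨c i, hc i⟩ : A) with hf
  have hfdeg : f.natDegree < p := by
    refine Nat.lt_of_le_pred hp.out.pos (natDegree_sum_le_of_forall_le _ _ fun i _ => ?_)
    exact (natDegree_monomial_le _).trans (Nat.le_pred_of_lt (ZMod.val_lt i))
  have hcoeff : f.coeff i.val = ⟨c i, hc i⟩ := by
    simp only [hf, finsetSum_coeff, coeff_monomial]
    rw [Finset.sum_eq_single i]
    · simp
    · intro j _ hj
      rw [if_neg fun h => hj (ZMod.val_injective p h)]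
    · simp
  -- `taylor 1 f` is `f(X + 1)`: its value at `ζ - 1` is `f(ζ)`, and its constant term is `f(1) = ∑
  -- c_i = 0`.
  have hmain := dvd_coeff_of_pow_dvd_aeval
    (sub_ne_zero.mpr (hζ.ne_one hp.out.one_lt)) hζ.associated_sub_one_pow_prime.dvd A hA
    (taylor 1 f) (by rwa [natDegree_taylor]) (by
      rw [taylor_coeff_zero, hf, eval_finsetSum]
      apply Subtype.ext
      simpa using hsum) (by
      rw [taylor_apply, aeval_comp]
      simp only [map_add, aeval_X, map_one, sub_add_cancel]
      rw [hf, map_sum]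
      convert hdvd using 2 with i
      rw [aeval_monomial, mul_comm]
      rfl)
  -- The coefficients of `f(X + 1)` vanish modulo `p`; the shift is invertible, so those of `f` do
  -- too. The quotient is that of `B`, since divisibility is known only there.
  let φ : A →+* B ⧸ Ideal.span {(p : B)} := (Ideal.Quotient.mk _).comp A.val.toRingHom
  have hφ : ∀ a : A, φ a = 0 ↔ (p : B) ∣ (a : B) := fun a =>
    (Ideal.Quotient.eq_zero_iff_mem).trans Ideal.mem_span_singleton
  have hzero : taylor (φ 1) (f.map φ) = 0 := by
    rw [← map_taylor]
    ext j
    rw [coeff_map, coeff_zero, hφ]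
    exact hmain j
  rw [taylor_eq_zero] at hzero
  have := congrArg (coeff · i.val) hzero
  simp only [coeff_map, coeff_zero, hφ, hcoeff] at this
  exact this

/-- Integer polynomials whose roots in an integral extension are congruent modulo `p` have the same
reduction modulo `p`. -/
theorem map_zmod_eq_of_dvd_sub {B : Type*} [CommRing B] {p : ℕ} [hp : Fact p.Prime]
    (hu : ¬ IsUnit (p : B)) {ι : Type*} [Fintype ι] {P Q : ℤ[X]} (a b : ι → B)
    (hP : P.map (Int.castRingHom B) = ∏ i, (X - C (a i)))
    (hQ : Q.map (Int.castRingHom B) = ∏ i, (X - C (b i))) (e : Equiv.Perm ι)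
    (h : ∀ i, (p : B) ∣ b i - a (e i)) :
    P.map (Int.castRingHom (ZMod p)) = Q.map (Int.castRingHom (ZMod p)) := by
  -- As `p` is not a unit, `B/p` contains `𝔽_p`, and the reductions can be compared over it.
  have : CharP (B ⧸ Ideal.span {(p : B)}) p := CharP.quotient B p hu
  have : Nontrivial (B ⧸ Ideal.span {(p : B)}) := CharP.nontrivial_of_char_ne_one hp.out.ne_one
  apply Polynomial.map_injective (ZMod.castHom dvd_rfl (B ⧸ Ideal.span {(p : B)}))
    (RingHom.injective _)
  have key : (P.map (Int.castRingHom B)).map (Ideal.Quotient.mk (Ideal.span {(p : B)})) =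
      (Q.map (Int.castRingHom B)).map (Ideal.Quotient.mk (Ideal.span {(p : B)})) := by
    rw [hP, hQ, ← Equiv.prod_comp e, Polynomial.map_prod, Polynomial.map_prod]
    refine Finset.prod_congr rfl fun i _ => ?_
    simp only [Polynomial.map_sub, map_X, map_C]
    rw [Ideal.Quotient.eq.mpr (Ideal.mem_span_singleton.mpr (h i))]
  rw [Polynomial.map_map, Polynomial.map_map] at key ⊢
  convert key using 2 <;> exact RingHom.ext_int _ _

/-! ### Gaussian periods and the Gauss sum. -/

open Classical in
/-- The Gaussian period `∑ ξ ^ x`, the sum being over those `x` at which the character `ψ` takes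
the value `ε`. -/
def gaussPeriod {ℓ : ℕ} [Fact ℓ.Prime] {Ω R : Type*} [Field Ω] [CommRing R]
    (ψ : (ZMod ℓ)ˣ →* Ω) (ξ : R) (ε : Ω) : R :=
  ∑ x : (ZMod ℓ)ˣ with ψ x = ε, ξ ^ (x : ZMod ℓ).val

theorem map_gaussPeriod {ℓ : ℕ} [Fact ℓ.Prime] {Ω R S : Type*} [Field Ω] [CommRing R] [CommRing S]
    (ψ : (ZMod ℓ)ˣ →* Ω) (ξ : R) (ε : Ω) {T : Type*} [FunLike T R S] [RingHomClass T R S] (f : T) :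
    f (gaussPeriod ψ ξ ε) = gaussPeriod ψ (f ξ) ε := by
  simp [gaussPeriod, map_sum, map_pow]

theorem pow_val_pow_val {ℓ : ℕ} [NeZero ℓ] {R : Type*} [Monoid R] {ξ : R} (hξ : ξ ^ ℓ = 1)
    (a b : ZMod ℓ) : (ξ ^ a.val) ^ b.val = ξ ^ (a * b).val := by
  rw [← pow_mul, ZMod.val_mul, ← pow_eq_pow_mod _ hξ]

/-- The substitution `x ↦ u x` multiplies the character value by `ψ u`. -/
theorem gaussPeriod_pow_val {ℓ : ℕ} [Fact ℓ.Prime] {Ω R : Type*} [Field Ω] [CommRing R]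
    (ψ : (ZMod ℓ)ˣ →* Ω) {ξ : R} (hξ : ξ ^ ℓ = 1) (ε : Ω) (u : (ZMod ℓ)ˣ) :
    gaussPeriod ψ (ξ ^ (u : ZMod ℓ).val) ε = gaussPeriod ψ ξ (ε * ψ u) := by
  have hu : ψ u ≠ 0 := ((Group.isUnit u).map ψ).ne_zero
  refine Finset.sum_equiv (Equiv.mulLeft u) (fun x => ?_) fun x _ => ?_
  · simp [mul_comm (ψ u), hu]
  · rw [pow_val_pow_val hξ]
    simp


theorem IsPrimitiveRoot.pow_val_injective {R : Type*} [CommRing R] {p : ℕ} [NeZero p]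
    {ζ : R} (hζ : IsPrimitiveRoot ζ p) : Function.Injective fun i : ZMod p => ζ ^ i.val :=
  fun i j h => ZMod.val_injective p (hζ.pow_inj (ZMod.val_lt i) (ZMod.val_lt j) h)

theorem pow_val_add {R : Type*} [Monoid R] {p : ℕ} [NeZero p] {ζ : R} (hζ : ζ ^ p = 1)
    (i j : ZMod p) : ζ ^ (i + j).val = ζ ^ i.val * ζ ^ j.val := by
  rw [← pow_add, ZMod.val_add, ← pow_eq_pow_mod _ hζ]

theorem pow_val_natCast {R : Type*} [Monoid R] {p : ℕ} {ζ : R} (hζ : ζ ^ p = 1)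
    (k : ℕ) : ζ ^ (k : ZMod p).val = ζ ^ k := by
  rw [ZMod.val_natCast, ← pow_eq_pow_mod _ hζ]

/-- The sum of all nontrivial powers of a root of unity of prime order. -/
theorem IsPrimitiveRoot.sum_units_pow_val {R : Type*} [CommRing R] [IsDomain R] {ℓ : ℕ}
    [hℓ : Fact ℓ.Prime] {ξ : R} (hξ : IsPrimitiveRoot ξ ℓ) :
    ∑ x : (ZMod ℓ)ˣ, ξ ^ (x : ZMod ℓ).val = -1 := by
  have h1 : ∑ a : ZMod ℓ, ξ ^ a.val = 0 := by
    rw [← hξ.geom_sum_eq_zero hℓ.out.one_lt]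
    refine Finset.sum_bij (fun a _ => a.val) (fun a _ => by simpa using ZMod.val_lt a)
      (fun a _ b _ h => ZMod.val_injective ℓ h) (fun k hk => ⟨k, Finset.mem_univ _, ?_⟩)
      (fun _ _ => rfl)
    exact ZMod.val_cast_of_lt (Finset.mem_range.mp hk)
  rw [← Finset.add_sum_erase _ _ (Finset.mem_univ 0), ZMod.val_zero, pow_zero] at h1
  rw [eq_neg_iff_add_eq_zero, add_comm, ← h1]
  congr 1
  refine Finset.sum_bij (fun x _ => (x : ZMod ℓ)) (fun x _ => by simp)
    (fun x _ y _ h => Units.ext h) (fun a ha => ?_) (fun _ _ => rfl)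
  exact ⟨Units.mk0 a (Finset.ne_of_mem_erase ha), Finset.mem_univ _, rfl⟩

theorem exists_eq_pow_val {ℓ p : ℕ} [Fact ℓ.Prime] {Ω : Type*} [Field Ω]
    {ζ : Ω} (hζ : ζ ^ p = 1) {g : (ZMod ℓ)ˣ} (hg : ∀ x, x ∈ Subgroup.zpowers g)
    {ψ : (ZMod ℓ)ˣ →* Ω} (hψ : ψ g = ζ) (x : (ZMod ℓ)ˣ) : ∃ i : ZMod p, ψ x = ζ ^ i.val := by
  obtain ⟨k, rfl⟩ := mem_powers_iff_mem_zpowers.mpr (hg x)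
  exact ⟨k, by rw [map_pow, hψ, pow_val_natCast hζ]⟩

-- The fibres of `ψ` are those of a discrete logarithm `d` with `ψ x = ζ^(d x)`, because `i ↦ ζ^i`
-- is injective on `ZMod p`.
open Classical in
theorem sum_fiber_eq_sum {ℓ p : ℕ} [Fact ℓ.Prime] [NeZero p] {Ω R : Type*} [Field Ω] [CommRing R]
    {ζ : Ω} (hζ : IsPrimitiveRoot ζ p) {g : (ZMod ℓ)ˣ} (hg : ∀ x, x ∈ Subgroup.zpowers g)
    {ψ : (ZMod ℓ)ˣ →* Ω} (hψ : ψ g = ζ) (f : (ZMod ℓ)ˣ → R) :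
    ∑ i : ZMod p, ∑ x : (ZMod ℓ)ˣ with ψ x = ζ ^ i.val, f x = ∑ x, f x := by
  choose d hd using exists_eq_pow_val hζ.pow_eq_one hg hψ
  rw [← Finset.sum_fiberwise _ d]
  simp only [hd, hζ.pow_val_injective.eq_iff]

/-- The value does not depend on `ℓ`, so differences of periods for two primes have sum zero. -/
theorem sum_gaussPeriod {ℓ p : ℕ} [Fact ℓ.Prime] [NeZero p] {Ω R : Type*} [Field Ω] [CommRing R]
    [IsDomain R] {ζ : Ω} (hζ : IsPrimitiveRoot ζ p) {g : (ZMod ℓ)ˣ}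
    (hg : ∀ x, x ∈ Subgroup.zpowers g) {ψ : (ZMod ℓ)ˣ →* Ω} (hψ : ψ g = ζ) {ξ : R}
    (hξ : IsPrimitiveRoot ξ ℓ) : ∑ i : ZMod p, gaussPeriod ψ ξ (ζ ^ i.val) = -1 := by
  rw [← hξ.sum_units_pow_val, ← sum_fiber_eq_sum hζ hg hψ]
  rfl

theorem tau_eq_sum_gaussPeriod {ℓ p : ℕ} [Fact ℓ.Prime] [NeZero p] {Ω : Type*} [Field Ω]
    {ζ : Ω} (hζ : IsPrimitiveRoot ζ p) {g : (ZMod ℓ)ˣ}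
    (hg : ∀ x, x ∈ Subgroup.zpowers g) {ψ : (ZMod ℓ)ˣ →* Ω} (hψ : ψ g = ζ) (ξ : Ω) :
    tau ψ ξ = -∑ i : ZMod p, ζ ^ i.val * gaussPeriod ψ ξ (ζ ^ i.val) := by
  classical
  rw [tau, ← sum_fiber_eq_sum hζ hg hψ]
  congr 1
  refine Finset.sum_congr rfl fun i _ => ?_
  rw [gaussPeriod, Finset.mul_sum]
  refine Finset.sum_congr (by congr) fun x hx => ?_
  rw [(Finset.mem_filter.mp hx).2]

/-! ### Galois theory of `ℚ(ξ)` and `F`: the periods as conjugates of the trace. -/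

theorem IsPrimitiveRoot.isCyclotomicExtension_adjoin_simple {Ω : Type*} [Field Ω] [CharZero Ω]
    {n : ℕ} (hn : n ≠ 0) {ξ : Ω} (hξ : IsPrimitiveRoot ξ n) :
    IsCyclotomicExtension {n} ℚ ℚ⟮ξ⟯ := by
  have : NeZero n := ⟨hn⟩
  change IsCyclotomicExtension {n} ℚ ℚ⟮ξ⟯.toSubalgebra
  rw [adjoin_simple_toSubalgebra_of_isAlgebraic
    ((hξ.isIntegral (Nat.pos_of_ne_zero hn)).tower_top (A := ℚ)).isAlgebraic]
  exact hξ.adjoin_isCyclotomicExtension ℚ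

theorem IsPrimitiveRoot.adjoinSimple_gen {Ω : Type*} [Field Ω] [CharZero Ω]
    {n : ℕ} {ξ : Ω} (hξ : IsPrimitiveRoot ξ n) : IsPrimitiveRoot (AdjoinSimple.gen ℚ ξ) n :=
  IsPrimitiveRoot.of_map_of_injective (f := algebraMap ℚ⟮ξ⟯ Ω) (by simpa using hξ)
    (algebraMap ℚ⟮ξ⟯ Ω).injective

/-- Every unit modulo `n` is realised by an automorphism of `ℚ(ξ)`. -/
theorem IsPrimitiveRoot.exists_galEquiv {Ω : Type*} [Field Ω] [CharZero Ω]
    {n : ℕ} (hn : n ≠ 0) {ξ : Ω} (hξ : IsPrimitiveRoot ξ n) :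
    ∃ e : Gal(ℚ⟮ξ⟯/ℚ) ≃* (ZMod n)ˣ, ∀ σ : Gal(ℚ⟮ξ⟯/ℚ),
      σ (AdjoinSimple.gen ℚ ξ) = AdjoinSimple.gen ℚ ξ ^ (e σ : ZMod n).val := by
  have : NeZero n := ⟨hn⟩
  have := hξ.isCyclotomicExtension_adjoin_simple hn
  -- `autEquivPow` refers to a root chosen by the library; only its cardinality count is used, to
  -- make `autToPow` for `ξ` itself bijective.
  have hcard : Nat.card Gal(ℚ⟮ξ⟯/ℚ) = Nat.card (ZMod n)ˣ := Nat.card_congr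
    (IsCyclotomicExtension.autEquivPow ℚ⟮ξ⟯
      (cyclotomic.irreducible_rat (Nat.pos_of_ne_zero hn))).toEquiv
  exact ⟨MulEquiv.ofBijective (hξ.adjoinSimple_gen.autToPow ℚ)
    ((Nat.bijective_iff_injective_and_card _).mpr
      ⟨hξ.adjoinSimple_gen.autToPow_injective ℚ, hcard⟩),
    fun σ => (hξ.adjoinSimple_gen.autToPow_spec ℚ σ).symm⟩

/-- In a cyclic group, the only subgroup of prime index is the kernel of any character of that
order. -/
theorem eq_ker_of_index_eq_prime {G M : Type*} [CommGroup G] [CommMonoid M] {p : ℕ} [hp : Fact p.Prime]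
    {γ : G} (hγ : ∀ x, x ∈ Subgroup.zpowers γ) {χ : G →* M}
    (hχ : IsPrimitiveRoot (χ γ) p) (H : Subgroup G) (hH : H.index = p) : H = χ.ker := by
  have hpow : ∀ k : ℤ, (p : ℤ) ∣ k → γ ^ k ∈ H := by
    rintro _ ⟨j, rfl⟩
    rw [zpow_mul, zpow_natCast, ← hH]
    exact H.zpow_mem (H.pow_index_mem γ) j
  have hker : ∀ k : ℤ, γ ^ k ∈ χ.ker ↔ (p : ℤ) ∣ k := by
    intro k
    have h1 : IsPrimitiveRoot (χ.toHomUnits γ) p :=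
      IsPrimitiveRoot.coe_units_iff.mp (by simpa using hχ)
    rw [← h1.zpow_eq_one_iff_dvd, ← map_zpow, MonoidHom.mem_ker, ← Units.val_eq_one,
      MonoidHom.coe_toHomUnits]
  ext x
  obtain ⟨k, rfl⟩ := Subgroup.mem_zpowers_iff.mp (hγ x)
  rw [hker]
  refine ⟨fun hk => ?_, hpow k⟩
  -- If `p ∤ k`, a Bézout relation puts `γ` itself in `H`, and the index would be `1`.
  by_contra hpk
  obtain ⟨a, b, hab⟩ := (Nat.prime_iff_prime_int.mp hp.out).coprime_iff_not_dvd.mpr hpk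
  have hmem : γ ∈ H := by
    rw [← zpow_one γ, ← hab, zpow_add]
    exact H.mul_mem (hpow _ ⟨a, mul_comm _ _⟩) (by rw [mul_comm, zpow_mul]; exact H.zpow_mem hk b)
  have htop : H = ⊤ := by
    rw [eq_top_iff]
    exact fun y _ => (Subgroup.zpowers_le.mpr hmem) (hγ y)
  rw [htop, Subgroup.index_top] at hH
  exact hp.out.ne_one hH.symm

/-- The Galois-theoretic description of the subfield of degree `p` of `ℚ(ξ)`. -/
theorem mem_fixingSubgroup_iff_character {Ω : Type*} [Field Ω] [CharZero Ω] {p ℓ : ℕ}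
    [Fact p.Prime] [hℓ : Fact ℓ.Prime] {ζ ξ : Ω} (hζ : IsPrimitiveRoot ζ p)
    (hξ : IsPrimitiveRoot ξ ℓ) {F : IntermediateField ℚ ℚ⟮ξ⟯} (hF : Module.finrank ℚ F = p)
    {g : (ZMod ℓ)ˣ} (hg : ∀ x, x ∈ Subgroup.zpowers g) {ψ : (ZMod ℓ)ˣ →* Ω} (hψ : ψ g = ζ)
    (e : Gal(ℚ⟮ξ⟯/ℚ) ≃* (ZMod ℓ)ˣ) (σ : Gal(ℚ⟮ξ⟯/ℚ)) :
    σ ∈ F.fixingSubgroup ↔ ψ (e σ) = 1 := by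
  have := hξ.isCyclotomicExtension_adjoin_simple hℓ.out.ne_zero
  have : IsGalois ℚ ℚ⟮ξ⟯ := IsCyclotomicExtension.isGalois {ℓ} ℚ _
  have hind : (F.fixingSubgroup.map e.toMonoidHom).index = p := by
    rw [← hF, finrank_eq_fixingSubgroup_index]
    exact Subgroup.index_map_equiv _ e
  have h := eq_ker_of_index_eq_prime hg (χ := ψ) (by rwa [hψ]) _ hind
  rw [← MonoidHom.mem_ker, ← h]
  exact (Subgroup.mem_map_iff_mem e.injective).symm

/-- The relative trace of `ξ` is a Gaussian period. -/
theorem relTrace_eq_gaussPeriod {Ω : Type*} [Field Ω] [CharZero Ω] {p ℓ : ℕ}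
    [Fact p.Prime] [hℓ : Fact ℓ.Prime] {ζ ξ : Ω} (hζ : IsPrimitiveRoot ζ p)
    (hξ : IsPrimitiveRoot ξ ℓ) {F : IntermediateField ℚ ℚ⟮ξ⟯} (hF : Module.finrank ℚ F = p)
    {g : (ZMod ℓ)ˣ} (hg : ∀ x, x ∈ Subgroup.zpowers g) {ψ : (ZMod ℓ)ˣ →* Ω} (hψ : ψ g = ζ) :
    (relTrace ξ F : ℚ⟮ξ⟯) = gaussPeriod ψ (AdjoinSimple.gen ℚ ξ) 1 := by
  obtain ⟨e, he⟩ := hξ.exists_galEquiv hℓ.out.ne_zero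
  have := hξ.isCyclotomicExtension_adjoin_simple hℓ.out.ne_zero
  have : IsGalois ℚ ℚ⟮ξ⟯ := IsCyclotomicExtension.isGalois {ℓ} ℚ _
  have : FiniteDimensional ℚ ℚ⟮ξ⟯ := IsCyclotomicExtension.finiteDimensional {ℓ} ℚ _
  have hmem := mem_fixingSubgroup_iff_character hζ hξ hF hg hψ e
  change algebraMap F ℚ⟮ξ⟯ (Algebra.trace F ℚ⟮ξ⟯ (AdjoinSimple.gen ℚ ξ)) = _
  rw [trace_eq_sum_automorphisms, gaussPeriod]
  let q := F.fixingSubgroupEquiv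
  refine Finset.sum_bij (fun σ _ => e (q.symm σ)) (fun σ _ => ?_) (fun σ _ τ _ h => ?_)
    (fun x hx => ?_) (fun σ _ => ?_)
  · simpa using (hmem _).mp (q.symm σ).2
  · exact q.symm.injective (Subtype.ext (e.injective h))
  · refine ⟨q ⟨e.symm x, (hmem _).mpr ?_⟩, Finset.mem_univ _, by simp⟩
    simpa using hx
  · rw [← he]
    rfl

theorem IsPrimitiveRoot.isAbelianGalois_intermediateField {Ω : Type*} [Field Ω] [CharZero Ω]
    {n : ℕ} (hn : n ≠ 0) {ξ : Ω} (hξ : IsPrimitiveRoot ξ n) (F : IntermediateField ℚ ℚ⟮ξ⟯) :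
    IsAbelianGalois ℚ F :=
  have := hξ.isCyclotomicExtension_adjoin_simple hn
  have : IsAbelianGalois ℚ ℚ⟮ξ⟯ := IsCyclotomicExtension.isAbelianGalois {n} ℚ _
  IsAbelianGalois.tower_bot ℚ F ℚ⟮ξ⟯

theorem coe_restrictNormalHom_apply {Ω : Type*} [Field Ω] [CharZero Ω] {ξ : Ω}
    (F : IntermediateField ℚ ℚ⟮ξ⟯) [Normal ℚ F] (σ : Gal(ℚ⟮ξ⟯/ℚ)) (x : F) :
    ((AlgEquiv.restrictNormalHom F σ x : F) : ℚ⟮ξ⟯) = σ x :=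
  AlgEquiv.restrictNormal_commutes σ F x

/-- The Gaussian periods are the conjugates of the relative trace of `ξ`. -/
theorem map_conjPoly_eq_prod_gaussPeriod {Ω : Type*} [Field Ω] [CharZero Ω] {p ℓ : ℕ}
    [hp : Fact p.Prime] [hℓ : Fact ℓ.Prime] {ζ ξ : Ω} (hζ : IsPrimitiveRoot ζ p)
    (hξ : IsPrimitiveRoot ξ ℓ) {F : IntermediateField ℚ ℚ⟮ξ⟯} (hF : Module.finrank ℚ F = p)
    {g : (ZMod ℓ)ˣ} (hg : ∀ x, x ∈ Subgroup.zpowers g) {ψ : (ZMod ℓ)ˣ →* Ω} (hψ : ψ g = ζ) :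
    ∃ t : ZMod p → F, (∀ i, (t i : ℚ⟮ξ⟯) = gaussPeriod ψ (AdjoinSimple.gen ℚ ξ) (ζ ^ i.val)) ∧
      conjPoly ξ F = ∏ i, (X - C (t i)) := by
  obtain ⟨e, he⟩ := hξ.exists_galEquiv hℓ.out.ne_zero
  have := hξ.isCyclotomicExtension_adjoin_simple hℓ.out.ne_zero
  have : IsGalois ℚ ℚ⟮ξ⟯ := IsCyclotomicExtension.isGalois {ℓ} ℚ _
  have : FiniteDimensional ℚ ℚ⟮ξ⟯ := IsCyclotomicExtension.finiteDimensional {ℓ} ℚ _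
  have := hξ.isAbelianGalois_intermediateField hℓ.out.ne_zero F
  set γ : Gal(F/ℚ) := AlgEquiv.restrictNormalHom F (e.symm g) with hγ
  have hgen : ∀ τ, τ ∈ Subgroup.zpowers γ := by
    intro τ
    obtain ⟨σ, rfl⟩ := AlgEquiv.restrictNormalHom_surjective (F := ℚ) (K₁ := F) ℚ⟮ξ⟯ τ
    obtain ⟨k, hk⟩ := Subgroup.mem_zpowers_iff.mp (hg (e σ))
    refine Subgroup.mem_zpowers_iff.mpr ⟨k, ?_⟩
    rw [hγ, ← map_zpow, ← map_zpow, hk, e.symm_apply_apply]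
  have hcard : Nat.card Gal(F/ℚ) = p := (IsGalois.card_aut_eq_finrank ℚ F).trans hF
  have horder : orderOf γ = p := (orderOf_eq_card_of_forall_mem_zpowers hgen).trans hcard
  have hbij : Function.Bijective fun i : ZMod p => γ ^ i.val := by
    refine (Nat.bijective_iff_injective_and_card _).mpr ⟨fun i j h => ?_,
      by rw [hcard, Nat.card_zmod]⟩
    refine ZMod.val_injective p (pow_injOn_Iio_orderOf ?_ ?_ h) <;>
      simpa [horder] using ZMod.val_lt _
  refine ⟨fun i => (γ ^ i.val) (relTrace ξ F), fun i => ?_, ?_⟩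
  · have hcoe : (((γ ^ i.val) (relTrace ξ F) : F) : ℚ⟮ξ⟯) = (e.symm (g ^ i.val)) (relTrace ξ F) := by
      rw [hγ, ← map_pow, ← map_pow, coe_restrictNormalHom_apply]
    rw [hcoe, relTrace_eq_gaussPeriod hζ hξ hF hg hψ, map_gaussPeriod, he, e.apply_symm_apply,
      gaussPeriod_pow_val _ hξ.adjoinSimple_gen.pow_eq_one, map_pow, hψ, one_mul]
  · rw [conjPoly, finprod_eq_prod_of_fintype, ← hbij.prod_comp]

theorem map_intPoly_eq_prod_gaussPeriod {Ω : Type*} [Field Ω] [CharZero Ω] {p ℓ : ℕ}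
    [hp : Fact p.Prime] [hℓ : Fact ℓ.Prime] {ζ ξ : Ω} (hζ : IsPrimitiveRoot ζ p)
    (hξ : IsPrimitiveRoot ξ ℓ) {F : IntermediateField ℚ ℚ⟮ξ⟯} (hF : Module.finrank ℚ F = p)
    {g : (ZMod ℓ)ˣ} (hg : ∀ x, x ∈ Subgroup.zpowers g) {ψ : (ZMod ℓ)ˣ →* Ω} (hψ : ψ g = ζ) :
    (intPoly ξ F).map (Int.castRingHom Ω) = ∏ i : ZMod p, (X - C (gaussPeriod ψ ξ (ζ ^ i.val))) := by
  obtain ⟨t, ht, hprod⟩ := map_conjPoly_eq_prod_gaussPeriod hζ hξ hF hg hψ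
  have h := congrArg (Polynomial.map ((algebraMap ℚ⟮ξ⟯ Ω).comp (algebraMap F ℚ⟮ξ⟯)))
    ((map_intPoly hℓ.out.ne_zero hξ F).trans hprod)
  rw [Polynomial.map_map, RingHom.ext_int (RingHom.comp _ _) (Int.castRingHom Ω),
    Polynomial.map_prod] at h
  rw [h]
  refine Finset.prod_congr rfl fun i _ => ?_
  simp only [Polynomial.map_sub, map_X, map_C, RingHom.comp_apply]
  change X - C (algebraMap ℚ⟮ξ⟯ Ω (t i : ℚ⟮ξ⟯)) = _
  rw [ht, map_gaussPeriod, AdjoinSimple.algebraMap_gen]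

/-- Automorphisms of an extension of `F` permute the Gaussian periods cyclically. -/
theorem exists_apply_gaussPeriod {Ω : Type*} [Field Ω] [CharZero Ω] {p ℓ : ℕ}
    [hp : Fact p.Prime] [hℓ : Fact ℓ.Prime] {ζ ξ : Ω} (hζ : IsPrimitiveRoot ζ p)
    (hξ : IsPrimitiveRoot ξ ℓ) {F : IntermediateField ℚ ℚ⟮ξ⟯} (hF : Module.finrank ℚ F = p)
    {g : (ZMod ℓ)ˣ} (hg : ∀ x, x ∈ Subgroup.zpowers g) {ψ : (ZMod ℓ)ˣ →* Ω} (hψ : ψ g = ζ)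
    {E : IntermediateField ℚ Ω} (hE : IntermediateField.lift F ≤ E) (σ : Gal(E/ℚ)) :
    ∃ (t : ZMod p → E) (d : ZMod p), (∀ i, (t i : Ω) = gaussPeriod ψ ξ (ζ ^ i.val)) ∧
      ∀ i, σ (t i) = t (i + d) := by
  obtain ⟨t, ht, -⟩ := map_conjPoly_eq_prod_gaussPeriod hζ hξ hF hg hψ
  obtain ⟨e, he⟩ := hξ.exists_galEquiv hℓ.out.ne_zero
  have := hξ.isCyclotomicExtension_adjoin_simple hℓ.out.ne_zero
  have : IsGalois ℚ ℚ⟮ξ⟯ := IsCyclotomicExtension.isGalois {ℓ} ℚ _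
  have := hξ.isAbelianGalois_intermediateField hℓ.out.ne_zero F
  let j : F →ₐ[ℚ] E :=
    (IntermediateField.inclusion hE).comp (IntermediateField.liftAlgEquiv F).toAlgHom
  have hj : ∀ x : F, (j x : Ω) = algebraMap ℚ⟮ξ⟯ Ω x := fun x => rfl
  let := j.toRingHom.toAlgebra
  have : IsScalarTower ℚ F E := IsScalarTower.of_algebraMap_eq fun x => (j.commutes x).symm
  -- `E` need not contain `ξ`, so `σ` is restricted to `F` and then lifted to `ℚ(ξ)`, where it
  -- raises `ξ` to a power.
  obtain ⟨δ, hδ⟩ := AlgEquiv.restrictNormalHom_surjective (F := ℚ) (K₁ := F) ℚ⟮ξ⟯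
    (σ.restrictNormal F)
  have hσ : ∀ x : F, σ (j x) = j (AlgEquiv.restrictNormalHom F δ x) := fun x => by
    rw [hδ]
    exact (σ.restrictNormal_commutes F x).symm
  obtain ⟨d, hd⟩ := exists_eq_pow_val hζ.pow_eq_one hg hψ (e δ)
  refine ⟨fun i => j (t i), d, fun i => ?_, fun i => ?_⟩
  · rw [hj, ht, map_gaussPeriod, AdjoinSimple.algebraMap_gen]
  · rw [hσ]
    congr 1
    apply Subtype.ext
    rw [coe_restrictNormalHom_apply, ht, ht, map_gaussPeriod, he,
      gaussPeriod_pow_val _ hξ.adjoinSimple_gen.pow_eq_one, hd, pow_val_add hζ.pow_eq_one]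

/-! ### The prime above `p`, and `ℤ[ξ₁, ξ₂]` at `p`. -/

theorem eq_span_toInteger_sub_one {Ω : Type*} [Field Ω] [CharZero Ω] {p : ℕ} [hp : Fact p.Prime]
    {ζ : Ω} (hζ : IsPrimitiveRoot ζ p) (𝔭 : Ideal (𝓞 ℚ⟮ζ⟯)) [h𝔭 : 𝔭.IsPrime]
    (hp𝔭 : (p : 𝓞 ℚ⟮ζ⟯) ∈ 𝔭) : 𝔭 = Ideal.span {hζ.adjoinSimple_gen.toInteger - 1} := by
  have := hζ.isCyclotomicExtension_adjoin_simple hp.out.ne_zero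
  have : NumberField ℚ⟮ζ⟯ := IsCyclotomicExtension.numberField {p} ℚ _
  have : 𝔭.LiesOver (Ideal.span {(p : ℤ)}) := by
    refine ⟨(Int.ideal_span_isMaximal_of_prime p).eq_of_le (Ideal.IsPrime.ne_top inferInstance) ?_⟩
    rw [Ideal.span_singleton_le_iff_mem, Ideal.mem_comap]
    simpa using hp𝔭
  exact IsCyclotomicExtension.Rat.eq_span_zeta_sub_one_of_liesOver' p _ hζ.adjoinSimple_gen 𝔭

theorem not_isUnit_natCast_integralClosure {Ω : Type*} [Field Ω] [CharZero Ω] {p : ℕ}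
    (hp : p.Prime) : ¬ IsUnit (p : integralClosure ℤ Ω) := by
  intro h
  have h2 : IsUnit (algebraMap ℤ (integralClosure ℤ Ω) p) := by simpa using h
  exact (Nat.prime_iff_prime_int.mp hp).not_isUnit (isUnit_of_map_unit _ _ h2)

/-- By Fermat, `p^m ≡ 1` modulo `ℓ`: the `m`-th iterate of `x ↦ x^p` fixes `ξ`. -/
theorem pow_prime_pow_eq_self {R : Type*} [Monoid R] {ξ : R} {p ℓ m : ℕ} (hℓ : ℓ.Prime)
    (hξ : ξ ^ ℓ = 1) (hpℓ : p.Coprime ℓ) (hm : ℓ - 1 ∣ m) : ξ ^ p ^ m = ξ := by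
  obtain ⟨k, rfl⟩ := hm
  have h : p ^ ((ℓ - 1) * k) % ℓ = 1 % ℓ := by
    rw [pow_mul, ← Nat.totient_prime hℓ]
    exact ((Nat.ModEq.pow_totient hpℓ).pow k).trans (by rw [one_pow])
  rw [pow_eq_pow_mod _ hξ, h, ← pow_eq_pow_mod _ hξ, pow_one]

theorem coprime_of_modEq_one {p ℓ : ℕ} (h : ℓ ≡ 1 [MOD p]) : p.Coprime ℓ := by
  rw [Nat.coprime_comm, Nat.coprime_iff_gcd_eq_one, h.gcd_eq, Nat.gcd_one_left]

/-- The ring generated by roots of unity of orders prime to `p` is unramified at `p`. -/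
theorem natCast_dvd_of_sub_one_dvd {B : Type*} [CommRing B] [IsDomain B] {p ℓ₁ ℓ₂ : ℕ}
    [hp : Fact p.Prime] (h₁ : ℓ₁.Prime) (h₂ : ℓ₂.Prime) (hp₁ : p.Coprime ℓ₁) (hp₂ : p.Coprime ℓ₂)
    {ζ ξ₁ ξ₂ : B} (hζ : IsPrimitiveRoot ζ p) (hξ₁ : ξ₁ ^ ℓ₁ = 1) (hξ₂ : ξ₂ ^ ℓ₂ = 1)
    {a : B} (ha : a ∈ Algebra.adjoin ℤ {ξ₁, ξ₂}) (hdvd : ζ - 1 ∣ a) : (p : B) ∣ a := by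
  have h := dvd_pow_prime_pow_sub_self_of_mem_adjoin (p := p) ((ℓ₁ - 1) * (ℓ₂ - 1)) {ξ₁, ξ₂} (by
    rintro s (rfl | rfl)
    · exact pow_prime_pow_eq_self h₁ hξ₁ hp₁ (dvd_mul_right _ _)
    · exact pow_prime_pow_eq_self h₂ hξ₂ hp₂ (dvd_mul_left _ _)) ha
  have hm : (ℓ₁ - 1) * (ℓ₂ - 1) ≠ 0 :=
    mul_ne_zero (Nat.sub_ne_zero_of_lt h₁.one_lt) (Nat.sub_ne_zero_of_lt h₂.one_lt)
  have hle : p - 1 ≤ p ^ ((ℓ₁ - 1) * (ℓ₂ - 1)) := (Nat.sub_le _ _).trans (Nat.le_self_pow hm p)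
  -- With `m = (ℓ₁-1)(ℓ₂-1)`, `p` divides `π^(p^m)`, hence `a^(p^m)`, which is congruent to `a`
  -- modulo `p`.
  have hpow := (hζ.associated_sub_one_pow_prime.symm.dvd.trans (pow_dvd_pow _ hle)).trans
    (pow_dvd_pow_of_dvd hdvd (p ^ ((ℓ₁ - 1) * (ℓ₂ - 1))))
  exact (dvd_sub_right hpow).mp h

/-! ### Integrality and conjugates of the Gauss sums. -/

theorem isIntegral_gaussPeriod {ℓ : ℕ} [hℓ : Fact ℓ.Prime] {Ω : Type*} [Field Ω]
    (ψ : (ZMod ℓ)ˣ →* Ω) {ξ : Ω} (hξ : IsPrimitiveRoot ξ ℓ) (ε : Ω) :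
    IsIntegral ℤ (gaussPeriod ψ ξ ε) :=
  IsIntegral.sum _ fun _ _ => (hξ.isIntegral hℓ.out.pos).pow _

theorem isIntegral_tau {ℓ p : ℕ} [hℓ : Fact ℓ.Prime] [hp : Fact p.Prime] {Ω : Type*} [Field Ω]
    {ζ : Ω} (hζ : IsPrimitiveRoot ζ p) {g : (ZMod ℓ)ˣ}
    (hg : ∀ x, x ∈ Subgroup.zpowers g) {ψ : (ZMod ℓ)ˣ →* Ω} (hψ : ψ g = ζ) {ξ : Ω}
    (hξ : IsPrimitiveRoot ξ ℓ) : IsIntegral ℤ (tau ψ ξ) := by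
  rw [tau_eq_sum_gaussPeriod hζ hg hψ]
  exact (IsIntegral.sum _ fun _ _ =>
    ((hζ.isIntegral hp.out.pos).pow _).mul (isIntegral_gaussPeriod ψ hξ _)).neg

theorem tau_mem {Ω : Type*} [Field Ω] [CharZero Ω] {p ℓ : ℕ}
    [hp : Fact p.Prime] [hℓ : Fact ℓ.Prime] {ζ ξ : Ω} (hζ : IsPrimitiveRoot ζ p)
    (hξ : IsPrimitiveRoot ξ ℓ) {F : IntermediateField ℚ ℚ⟮ξ⟯} (hF : Module.finrank ℚ F = p)
    {g : (ZMod ℓ)ˣ} (hg : ∀ x, x ∈ Subgroup.zpowers g) {ψ : (ZMod ℓ)ˣ →* Ω} (hψ : ψ g = ζ)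
    {E : IntermediateField ℚ Ω} (hE : IntermediateField.lift F ≤ E) (hζE : ζ ∈ E) :
    tau ψ ξ ∈ E := by
  obtain ⟨t, -, ht, -⟩ := exists_apply_gaussPeriod hζ hξ hF hg hψ hE AlgEquiv.refl
  rw [tau_eq_sum_gaussPeriod hζ hg hψ]
  refine E.neg_mem (sum_mem fun i _ => mul_mem (pow_mem hζE _) ?_)
  rw [← ht]
  exact (t i).2

/-- The conjugates of a Gauss sum are obtained by an affine permutation of the Gaussian periods. -/
theorem exists_perm_apply_tau {Ω : Type*} [Field Ω] [CharZero Ω] {p ℓ : ℕ}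
    [hp : Fact p.Prime] [hℓ : Fact ℓ.Prime] {ζ ξ : Ω} (hζ : IsPrimitiveRoot ζ p)
    (hξ : IsPrimitiveRoot ξ ℓ) {F : IntermediateField ℚ ℚ⟮ξ⟯} (hF : Module.finrank ℚ F = p)
    {g : (ZMod ℓ)ˣ} (hg : ∀ x, x ∈ Subgroup.zpowers g) {ψ : (ZMod ℓ)ˣ →* Ω} (hψ : ψ g = ζ)
    {E : IntermediateField ℚ Ω} (hE : IntermediateField.lift F ≤ E) (hζE : ζ ∈ E)
    (σ : Gal(E/ℚ)) {T : E} (hT : (T : Ω) = tau ψ ξ) :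
    ∃ e : Equiv.Perm (ZMod p), (σ T : Ω) =
      -∑ i : ZMod p, ζ ^ i.val * gaussPeriod ψ ξ (ζ ^ (e i).val) := by
  obtain ⟨t, d, ht, hσ⟩ := exists_apply_gaussPeriod hζ hξ hF hg hψ hE σ
  have hζ' : IsPrimitiveRoot (⟨ζ, hζE⟩ : E) p :=
    IsPrimitiveRoot.of_map_of_injective (f := algebraMap E Ω) hζ (algebraMap E Ω).injective
  obtain ⟨k, -, hk, hσζ⟩ := hζ'.isPrimitiveRoot_iff.mp (hζ'.map_of_injective σ.injective)
  have hk0 : (k : ZMod p) ≠ 0 := by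
    rw [Ne, ZMod.natCast_eq_zero_iff]
    exact (hp.out.coprime_iff_not_dvd).mp hk.symm
  -- From `σ ζ = ζ^k` and `σ t_i = t_(i+d)`, the term `ζ^i t_i` goes to `ζ^(ki) t_(i+d)`; reindexing
  -- by `k i` gives `e i = k⁻¹ i + d`.
  refine ⟨(Equiv.mulLeft₀ _ hk0).symm.trans (Equiv.addRight d), ?_⟩
  have hT' : T = -∑ i, (⟨ζ, hζE⟩ : E) ^ i.val * t i := by
    apply Subtype.ext
    rw [hT, tau_eq_sum_gaussPeriod hζ hg hψ]
    simp [ht]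
  rw [hT', ← Equiv.sum_comp (Equiv.mulLeft₀ _ hk0) fun i => _ * gaussPeriod ψ ξ (ζ ^ _)]
  simp only [map_neg, map_sum, map_mul, map_pow, ← hσζ, hσ]
  push_cast
  simp only [ht]
  congr 1
  refine Finset.sum_congr rfl fun i _ => ?_
  rw [← pow_mul, Equiv.trans_apply, Equiv.symm_apply_apply, Equiv.coe_addRight,
    ← pow_val_natCast hζ.pow_eq_one (k * i.val)]
  simp

/-! ### From the congruence to equality of the reduced polynomials. -/

/-- If a linear combination of differences of Gaussian periods is divisible by `(ζ - 1) ^ p`, then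
the period polynomials agree modulo `p`. -/
theorem redPoly_eq_of_sub_one_pow_dvd {Ω B : Type*} [Field Ω] [CharZero Ω] [CommRing B] [IsDomain B]
    [Algebra B Ω] (hinj : Function.Injective (algebraMap B Ω)) {p ℓ₁ ℓ₂ : ℕ}
    [Fact p.Prime] [Fact ℓ₁.Prime] [Fact ℓ₂.Prime] (hu : ¬ IsUnit (p : B))
    (hℓ₁ : ℓ₁ ≡ 1 [MOD p]) (hℓ₂ : ℓ₂ ≡ 1 [MOD p]) {ζ ξ₁ ξ₂ : Ω} {ζB ξB₁ ξB₂ : B}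
    (hζB : algebraMap B Ω ζB = ζ) (hξB₁ : algebraMap B Ω ξB₁ = ξ₁) (hξB₂ : algebraMap B Ω ξB₂ = ξ₂)
    (hζ : IsPrimitiveRoot ζ p) (hξ₁ : IsPrimitiveRoot ξ₁ ℓ₁) (hξ₂ : IsPrimitiveRoot ξ₂ ℓ₂)
    {F₁ : IntermediateField ℚ ℚ⟮ξ₁⟯} (hF₁ : Module.finrank ℚ F₁ = p)
    {F₂ : IntermediateField ℚ ℚ⟮ξ₂⟯} (hF₂ : Module.finrank ℚ F₂ = p)
    {g₁ : (ZMod ℓ₁)ˣ} (hg₁ : ∀ x, x ∈ Subgroup.zpowers g₁)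
    {g₂ : (ZMod ℓ₂)ˣ} (hg₂ : ∀ x, x ∈ Subgroup.zpowers g₂)
    {ψ₁ : (ZMod ℓ₁)ˣ →* Ω} (hψ₁ : ψ₁ g₁ = ζ) {ψ₂ : (ZMod ℓ₂)ˣ →* Ω} (hψ₂ : ψ₂ g₂ = ζ)
    (e : Equiv.Perm (ZMod p))
    (hdvd : (ζB - 1) ^ p ∣ ∑ i : ZMod p, ζB ^ i.val *
      (gaussPeriod ψ₁ ξB₁ (ζ ^ (e i).val) - gaussPeriod ψ₂ ξB₂ (ζ ^ i.val))) :
    redPoly p ξ₁ F₁ = redPoly p ξ₂ F₂ := by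
  have pζB : IsPrimitiveRoot ζB p :=
    .of_map_of_injective (f := algebraMap B Ω) (by rwa [hζB]) hinj
  have pξB₁ : IsPrimitiveRoot ξB₁ ℓ₁ :=
    .of_map_of_injective (f := algebraMap B Ω) (by rwa [hξB₁]) hinj
  have pξB₂ : IsPrimitiveRoot ξB₂ ℓ₂ :=
    .of_map_of_injective (f := algebraMap B Ω) (by rwa [hξB₂]) hinj
  let c : ZMod p → B := fun i =>
    gaussPeriod ψ₁ ξB₁ (ζ ^ (e i).val) - gaussPeriod ψ₂ ξB₂ (ζ ^ i.val)
  have hmemA : ∀ i, c i ∈ Algebra.adjoin ℤ {ξB₁, ξB₂} := fun i =>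
    sub_mem (sum_mem fun _ _ => pow_mem (Algebra.subset_adjoin (by simp)) _)
      (sum_mem fun _ _ => pow_mem (Algebra.subset_adjoin (by simp)) _)
  have hsum : ∑ i, c i = 0 := by
    rw [Finset.sum_sub_distrib, Equiv.sum_comp e fun i => gaussPeriod ψ₁ ξB₁ (ζ ^ i.val),
      sum_gaussPeriod hζ hg₁ hψ₁ pξB₁, sum_gaussPeriod hζ hg₂ hψ₂ pξB₂, sub_self]
  have hc := dvd_of_sub_one_pow_dvd_sum pζB _ (fun a ha => natCast_dvd_of_sub_one_dvd
    Fact.out Fact.out (coprime_of_modEq_one hℓ₁) (coprime_of_modEq_one hℓ₂) pζB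
    pξB₁.pow_eq_one pξB₂.pow_eq_one ha) c hmemA hsum hdvd
  have hpoly : ∀ {P : ℤ[X]} {a : ZMod p → B}, P.map (Int.castRingHom Ω) =
      ∏ i, (X - C (algebraMap B Ω (a i))) → P.map (Int.castRingHom B) = ∏ i, (X - C (a i)) := by
    intro P a h
    apply Polynomial.map_injective _ hinj
    rw [Polynomial.map_map, RingHom.ext_int (RingHom.comp _ _) (Int.castRingHom Ω), h,
      Polynomial.map_prod]
    simp
  have h₁ : (intPoly ξ₁ F₁).map (Int.castRingHom B) =
      ∏ i : ZMod p, (X - C (gaussPeriod ψ₁ ξB₁ (ζ ^ i.val))) := by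
    apply hpoly
    simpa only [map_gaussPeriod, hξB₁] using map_intPoly_eq_prod_gaussPeriod hζ hξ₁ hF₁ hg₁ hψ₁
  have h₂ : (intPoly ξ₂ F₂).map (Int.castRingHom B) =
      ∏ i : ZMod p, (X - C (gaussPeriod ψ₂ ξB₂ (ζ ^ i.val))) := by
    apply hpoly
    simpa only [map_gaussPeriod, hξB₂] using map_intPoly_eq_prod_gaussPeriod hζ hξ₂ hF₂ hg₂ hψ₂
  exact map_zmod_eq_of_dvd_sub hu _ _ h₁ h₂ e fun i => (dvd_sub_comm).mp (hc i)

end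

theorem proposition5p3 {Ω : Type*} [Field Ω] [CharZero Ω]
    -- an odd prime `p`, a primitive `p`-th root of unity `ζ`, and `K = ℚ(ζ)`
    (p : ℕ) [Fact p.Prime] (hp : p ≠ 2) (ζ : Ω) (hζ : IsPrimitiveRoot ζ p)
    -- the prime ideal of `K` above `p`
    (𝔭 : Ideal (𝓞 ℚ⟮ζ⟯)) (h𝔭 : 𝔭.IsPrime) (hp𝔭 : (p : 𝓞 ℚ⟮ζ⟯) ∈ 𝔭)
    -- two primes congruent to 1 modulo `p`, with primitive roots of unity of these orders
    (ℓ₁ ℓ₂ : ℕ) [Fact ℓ₁.Prime] [Fact ℓ₂.Prime] (hℓ₁ : ℓ₁ ≡ 1 [MOD p]) (hℓ₂ : ℓ₂ ≡ 1 [MOD p])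
    (ξ₁ ξ₂ : Ω) (hξ₁ : IsPrimitiveRoot ξ₁ ℓ₁) (hξ₂ : IsPrimitiveRoot ξ₂ ℓ₂)
    -- the subfields of degree `p` of `ℚ(ξ₁)` and `ℚ(ξ₂)`
    (F₁ : IntermediateField ℚ ℚ⟮ξ₁⟯) (hF₁ : Module.finrank ℚ F₁ = p)
    (F₂ : IntermediateField ℚ ℚ⟮ξ₂⟯) (hF₂ : Module.finrank ℚ F₂ = p)
    -- primitive roots modulo the two primes, and the characters sending them to `ζ`
    (g₁ : (ZMod ℓ₁)ˣ) (hg₁ : ∀ x, x ∈ Subgroup.zpowers g₁)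
    (g₂ : (ZMod ℓ₂)ˣ) (hg₂ : ∀ x, x ∈ Subgroup.zpowers g₂)
    (ψ₁ : (ZMod ℓ₁)ˣ →* Ω) (hψ₁ : ψ₁ g₁ = ζ) (ψ₂ : (ZMod ℓ₂)ˣ →* Ω) (hψ₂ : ψ₂ g₂ = ζ) :
    -- the Gauss sums are algebraic integers of `F₁F₂K`, and the non-congruence holds there
    ∃ t₁ t₂ : 𝓞 (compositumFK ζ F₁ F₂),
      ((t₁ : compositumFK ζ F₁ F₂) : Ω) = tau ψ₁ ξ₁ ∧
      ((t₂ : compositumFK ζ F₁ F₂) : Ω) = tau ψ₂ ξ₂ ∧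
      (redPoly p ξ₁ F₁ ≠ redPoly p ξ₂ F₂ →
        ∀ σ : Gal(compositumFK ζ F₁ F₂/ℚ),
          t₂ - σ • t₁ ∉ (𝔭 ^ p).map (inclFK ζ F₁ F₂)) := by
  have hζE : ζ ∈ compositumFK ζ F₁ F₂ :=
    (le_sup_right : ℚ⟮ζ⟯ ≤ compositumFK ζ F₁ F₂) (mem_adjoin_simple_self ℚ ζ)
  have hE₁ : IntermediateField.lift F₁ ≤ compositumFK ζ F₁ F₂ := le_sup_left.trans le_sup_left
  have hE₂ : IntermediateField.lift F₂ ≤ compositumFK ζ F₁ F₂ := le_sup_right.trans le_sup_left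
  have hint : ∀ x : compositumFK ζ F₁ F₂, IsIntegral ℤ (x : Ω) → IsIntegral ℤ x := fun x hx =>
    (isIntegral_algebraMap_iff (algebraMap (compositumFK ζ F₁ F₂) Ω).injective).mp hx
  refine ⟨⟨⟨_, tau_mem hζ hξ₁ hF₁ hg₁ hψ₁ hE₁ hζE⟩, hint _ (isIntegral_tau hζ hg₁ hψ₁ hξ₁)⟩,
    ⟨⟨_, tau_mem hζ hξ₂ hF₂ hg₂ hψ₂ hE₂ hζE⟩, hint _ (isIntegral_tau hζ hg₂ hψ₂ hξ₂)⟩,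
    rfl, rfl, fun hne σ hmem => hne ?_⟩
  obtain ⟨e, he⟩ := exists_perm_apply_tau hζ hξ₁ hF₁ hg₁ hψ₁ hE₁ hζE σ
    (T := ⟨_, tau_mem hζ hξ₁ hF₁ hg₁ hψ₁ hE₁ hζE⟩) rfl
  refine redPoly_eq_of_sub_one_pow_dvd (FaithfulSMul.algebraMap_injective (integralClosure ℤ Ω) Ω)
    (not_isUnit_natCast_integralClosure Fact.out) hℓ₁ hℓ₂
    (ζB := ⟨ζ, hζ.isIntegral (Nat.Prime.pos Fact.out)⟩)
    (ξB₁ := ⟨ξ₁, hξ₁.isIntegral (Nat.Prime.pos Fact.out)⟩)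
    (ξB₂ := ⟨ξ₂, hξ₂.isIntegral (Nat.Prime.pos Fact.out)⟩)
    rfl rfl rfl hζ hξ₁ hξ₂ hF₁ hF₂ hg₁ hg₂ hψ₁ hψ₂ e ?_
  -- The argument needs `ξ₁` and `ξ₂`, which `FK` need not contain; divisibility by `(ζ - 1)^p`
  -- persists in the integral closure of `ℤ` in `Ω`.
  let θ : 𝓞 (compositumFK ζ F₁ F₂) →+* integralClosure ℤ Ω :=
    (((compositumFK ζ F₁ F₂).val.restrictScalars ℤ).mapIntegralClosure).toRingHom
  have h := Ideal.mem_map_of_mem θ hmem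
  rw [Ideal.map_map, Ideal.map_pow, eq_span_toInteger_sub_one hζ 𝔭 hp𝔭, Ideal.map_span,
    Set.image_singleton, Ideal.span_singleton_pow, Ideal.mem_span_singleton] at h
  have hπ : (θ.comp (inclFK ζ F₁ F₂)) (hζ.adjoinSimple_gen.toInteger - 1) =
      ⟨ζ, hζ.isIntegral (Nat.Prime.pos Fact.out)⟩ - 1 := by
    rw [map_sub, map_one]
    rfl
  rw [hπ] at h
  convert h using 1
  apply FaithfulSMul.algebraMap_injective (integralClosure ℤ Ω) Ω
  rw [map_sum]
  simp only [map_mul, map_pow, map_sub, map_gaussPeriod]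
  have hθ : ∀ x, algebraMap (integralClosure ℤ Ω) Ω (θ x) =
      ((x : compositumFK ζ F₁ F₂) : Ω) := fun x => rfl
  simp only [hθ]
  change _ = tau ψ₂ ξ₂ - ((σ ⟨tau ψ₁ ξ₁, _⟩ : compositumFK ζ F₁ F₂) : Ω)
  rw [he, tau_eq_sum_gaussPeriod hζ hg₂ hψ₂, sub_neg_eq_add, neg_add_eq_sub,
    ← Finset.sum_sub_distrib]
  exact Finset.sum_congr rfl fun i _ => mul_sub _ _ _
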